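/- **Conventions.** An algebra here is a nonempty set $S$ with finitely many finitary operations $f_1,\dots,f_k$ of arities $r_1,\dots,r_k\ge 0$. For words $w_1,\dots,w_n$ over the one-letter alphabet $\{a\}$, $\mathrm{conv}(w_1,\dots,w_n)$ is the word over $\{a,\$\}^n$ of length $\max_i|w_i|$ whose $j$-th letter is the tuple of the $j$-th letters of $w_1,\dots,w_n$, with $\$$ in place of each missing letter. A unary FA-presentation $(a^*,\varphi)$ of $(S,f_1,\dots,f_k)$ is a surjective map $\varphi:a^*\to S$ (not necessarily injective) such that $\{\mathrm{conv}(w_1,w_2) : w_1\varphi=w_2\varphi\}$ and, for each $j$, $\{\mathrm{conv}(w_1,\dots,w_{r_j},v) : (w_1\varphi,\dots,w_{r_j}\varphi)f_j=v\varphi\}$ are regular languages. It is given to an algorithm as the list of the arities $r_j$ together with finite (possibly nondeterministic) automata accepting exactly these $k+1$ languages. **Theorem.** There is a single algorithm that takes as input a unary FA-presentation $(a^*,\varphi)$ of an algebra $\mathcal S$ (of any finite signature), a finite set $X\subseteq a^*$ and a word $w\in a^*$, and that always halts on such an input and decides whether $w\varphi$ lies in the subalgebra of $\mathcal S$ generated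 by $X\varphi$. -/

import Mathlib

universe u v w

/-- The convolution of an `n`-tuple of words over `A`: the word over `(A ∪ {$})ⁿ` whose `j`-th letter
lists the `j`-th letters of the words, words that are too short being padded with the
symbol `$`, which is `none : Option A`. -/
def conv {A : Type*} {n : ℕ} (x : Fin n → List A) : List (Fin n → Option A) :=
  (List.range (Finset.univ.sup fun i => (x i).length)).map fun j i => (x i)[j]?

/-- A (nondeterministic) finite multi-tape automaton over the one-letter alphabet `{a}`,
written out as finite data.
The states are the numbers below `states`; a transition `(p, x, q)` leads from `p` to `q` and reads
the tuple `x` of symbols from `{a, $}`, where `a` is `some ()` and `$` is `none`. -/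
structure AutomatonCode where
  states : ℕ
  initial : List ℕ
  final : List ℕ
  trans : List (ℕ × List (Option Unit) × ℕ)

namespace AutomatonCode

def equivProd :
    AutomatonCode ≃ ℕ × List ℕ × List ℕ × List (ℕ × List (Option Unit) × ℕ) where
  toFun c := (c.states, c.initial, c.final, c.trans)
  invFun p := ⟨p.1, p.2.1, p.2.2.1, p.2.2.2⟩
  left_inv _ := rfl
  right_inv _ := rfl

instance : Primcodable AutomatonCode := Primcodable.ofEquiv _ equivProd

/-- The finite automaton with `n` tapes that the code describes. -/
def toNFA (c : AutomatonCode) (n : ℕ) : NFA (Fin n → Option Unit) (Fin c.states) where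
  step p x := {q | ((p : ℕ), List.ofFn x, (q : ℕ)) ∈ c.trans}
  start := {q | (q : ℕ) ∈ c.initial}
  accept := {q | (q : ℕ) ∈ c.final}

/-- The automaton recognizes the relation `R` on words over `{a}`: the language that it accepts
is `conv R`. -/
def Recognizes (c : AutomatonCode) {n : ℕ} (R : Set (Fin n → List Unit)) : Prop :=
  (c.toNFA n).accepts = (conv '' R : Set (List (Fin n → Option Unit)))

end AutomatonCode

/-- The finite data by which a unary FA-presentation of an algebra is given to an algorithm:
an automaton for equality and, for each operation, its arity and an automaton for its graph. -/
structure UnaryFACode where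
  eqAut : AutomatonCode
  ops : List (ℕ × AutomatonCode)

namespace UnaryFACode

def equivProd : UnaryFACode ≃ AutomatonCode × List (ℕ × AutomatonCode) where
  toFun d := (d.eqAut, d.ops)
  invFun p := ⟨p.1, p.2⟩
  left_inv _ := rfl
  right_inv _ := rfl

instance : Primcodable UnaryFACode := Primcodable.ofEquiv _ equivProd

end UnaryFACode

/-- The relation `Λ(R, φ)` on words induced by a relation `R` on the set that `φ` maps to. -/
def wordRel {S : Type*} {n : ℕ} (φ : List Unit → S) (R : (Fin n → S) → Prop) :
    Set (Fin n → List Unit) :=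
  {x | R fun i => φ (x i)}

/-- `(a^*, φ)` is a unary FA-presentation of the algebra `S`, witnessed by the automata in `d`.
The finitely many operation symbols of `S` are enumerated by `e`; an operation `f` of arity `k`
is regarded as the `(k + 1)`-ary relation `f (s₀, …, s_{k-1}) = s_k`. -/
structure IsUnaryFAPresentation {L : FirstOrder.Language.{u, v}} {S : Type w} [L.Structure S]
    (d : UnaryFACode) (e : Fin d.ops.length ≃ Σ k : ℕ, L.Functions k)
    (φ : List Unit → S) : Prop where
  surjective : Function.Surjective φ
  eq_recognizes : d.eqAut.Recognizes (wordRel φ fun s : Fin 2 → S => s 0 = s 1)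
  arity_eq : ∀ j, (d.ops.get j).1 = (e j).1
  op_recognizes : ∀ j, (d.ops.get j).2.Recognizes
    (wordRel φ fun s : Fin ((e j).1 + 1) → S =>
      FirstOrder.Language.Structure.funMap (e j).2 (fun i => s i.castSucc) = s (Fin.last _))

/-! Words over `a` are lengths, so a set of words is a set `Y` of natural numbers, read as a 0-1
sequence. The element `φ x` lies outside the generated subalgebra iff some `Y` contains the lengths
of `X`, omits that of `x`, and is closed under every operation automaton and under the equality
automaton, taken as a relation with one input (`closedBelow_of_substructure`, `mem_of_closed`).

Closedness is a safety property of the sequence that a finite deterministic automaton can monitor.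
Its state records, for each given automaton, the pairs (state, tapes still running) reached by
tuples that may yet have all inputs in `Y` and the output outside. A tape ending at time `t` is
tested against `Y t` only, so one bit updates the state (`configs_succ`, `badConfigs_iff`).

If `Y` is closed below `B` plus the number of monitor states, a state repeats after time `B`, and
looping there gives a set closed everywhere that agrees with `Y` below `B` (`exists_safe_extension`,
`exists_closed_extension`). With `B` above all lengths in the input, non-membership becomes a search
among subsets of a computable finite interval (`notMem_closure_iff`, `refutable_iff`), and this
search is primitive recursive. -/

/-! ### Pumping for deterministic safety automata -/

section SafetyAutomaton

/-- The deterministic run on the truth values of `Y`. -/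
def safetyRun {σ : Type*} (init : σ) (next : σ → Prop → σ) (Y : ℕ → Prop) : ℕ → σ
  | 0 => init
  | t + 1 => next (safetyRun init next Y t) (Y t)

/-- The time reached from `0` in `t` steps when stepping to `t₂` leads back to `t₁`. -/
def loopTime (t₁ t₂ : ℕ) : ℕ → ℕ
  | 0 => 0
  | t + 1 => if loopTime t₁ t₂ t + 1 = t₂ then t₁ else loopTime t₁ t₂ t + 1

theorem loopTime_lt {t₁ t₂ : ℕ} (h : t₁ < t₂) (t : ℕ) : loopTime t₁ t₂ t < t₂ := by
  induction t with
  | zero => simp only [loopTime]; omega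
  | succ t ih => simp only [loopTime]; split <;> omega

theorem loopTime_of_lt {t₁ t₂ t : ℕ} (h : t < t₂) : loopTime t₁ t₂ t = t := by
  induction t with
  | zero => rfl
  | succ t ih => simp only [loopTime, ih (by omega)]; split <;> omega

/-- The state is the same at `t₁` and `t₂`, so the run cannot notice the jump back. -/
theorem safetyRun_loop {σ : Type*} {init : σ} {next : σ → Prop → σ} {Y : ℕ → Prop} {t₁ t₂ : ℕ}
    (heq : safetyRun init next Y t₁ = safetyRun init next Y t₂) (t : ℕ) :
    safetyRun init next (fun s => Y (loopTime t₁ t₂ s)) t =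
      safetyRun init next Y (loopTime t₁ t₂ t) := by
  induction t with
  | zero => rfl
  | succ t ih =>
    rw [safetyRun, ih, loopTime]
    split
    · next h' => rw [heq]; conv_rhs => rw [← h', safetyRun]
    · rfl

/-- A finite safety automaton that survives long enough on `Y` survives forever on a sequence
agreeing with `Y` on a prescribed initial segment. -/
theorem exists_safe_extension {σ : Type*} [Finite σ] (init : σ) (next : σ → Prop → σ)
    (bad : σ → Prop → Prop) (Y : ℕ → Prop) {B T : ℕ} (hT : B + Nat.card σ ≤ T)
    (hsafe : ∀ t < T, ¬ bad (safetyRun init next Y t) (Y t)) :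
    ∃ Z : ℕ → Prop, (∀ t < B, Z t ↔ Y t) ∧ ∀ t, ¬ bad (safetyRun init next Z t) (Z t) := by
  have := Fintype.ofFinite σ
  -- Pigeonhole on the times `B, …, B + Nat.card σ`: the loop starts no earlier than `B`, and all
  -- looped times stay below `T`.
  obtain ⟨i, j, hij, heq⟩ := Fintype.exists_ne_map_eq_of_card_lt
    (fun i : Fin (Nat.card σ + 1) => safetyRun init next Y (B + i))
    (by simp [Nat.card_eq_fintype_card])
  wlog hlt : i < j generalizing i j
  · exact this j i hij.symm heq.symm (lt_of_le_of_ne (not_lt.1 hlt) hij.symm)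
  have hlt' : B + (i : ℕ) < B + j := by simpa using hlt
  refine ⟨fun s => Y (loopTime (B + i) (B + j) s), fun t ht => ?_, fun t => ?_⟩
  · simp only [loopTime_of_lt (show t < B + j by omega)]
  · rw [safetyRun_loop heq]
    apply hsafe
    have := loopTime_lt hlt' t
    omega

end SafetyAutomaton

/-! ### Convolutions of unary words as tuples of lengths -/

section Tuples

variable {n : ℕ}

/-- The `t`-th letter of the convolution of words of lengths `m i`. -/
def padLetter (m : Fin n → ℕ) (t : ℕ) : Fin n → Option Unit :=
  fun i => if t < m i then some () else none

/-- The convolution of words of lengths `m i`. -/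
def padWord (m : Fin n → ℕ) : List (Fin n → Option Unit) :=
  (List.range (Finset.univ.sup m)).map (padLetter m)

theorem unit_getElem? (l : List Unit) (t : ℕ) :
    l[t]? = if t < l.length then some () else none := by
  split
  · next h => rw [List.getElem?_eq_getElem h]
  · next h => exact List.getElem?_eq_none (by omega)

theorem conv_eq_padWord (x : Fin n → List Unit) : conv x = padWord fun i => (x i).length := by
  simp only [conv, padWord, unit_getElem?]
  rfl

/-- Each word can be read off its own tape. Hence acceptance of a single convolution decides whether
that very tuple is in the relation. -/
theorem conv_injective {A : Type*} : Function.Injective (conv : (Fin n → List A) → List (Fin n → Option A)) := by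
  have key : ∀ (x : Fin n → List A) (i : Fin n) (t : ℕ), (x i)[t]? =
      ((conv x)[t]? : Option (Fin n → Option A)).bind fun f => f i := by
    intro x i t
    simp only [conv, List.getElem?_map]
    by_cases h : t < Finset.univ.sup fun i => (x i).length
    · simp [List.getElem?_range h]
    · rw [List.getElem?_eq_none (l := List.range _) (by simpa using h)]
      refine List.getElem?_eq_none (le_trans ?_ (not_lt.1 h))
      exact Finset.le_sup (f := fun i => (x i).length) (Finset.mem_univ i)
  intro x y h
  funext i
  refine List.ext_getElem? fun t => ?_
  rw [key, key, h]

theorem AutomatonCode.Recognizes.iff {c : AutomatonCode} {R : Set (Fin n → List Unit)}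
    (h : c.Recognizes R) (x : Fin n → List Unit) :
    padWord (fun i => (x i).length) ∈ (c.toNFA n).accepts ↔ x ∈ R := by
  rw [← conv_eq_padWord, h]
  exact conv_injective.mem_set_image

end Tuples

/-! ### Subset construction tracking violations of closedness -/

section Configurations

variable {σ : Type*} {r : ℕ} (M : NFA (Fin (r + 1) → Option Unit) σ) (Y : ℕ → Prop)

/-- The membership requirement on the entry `i` of a tuple violating closedness: inputs
are members, the output is not. -/
def Admissible (b : Prop) (i : Fin (r + 1)) : Prop := if i = Fin.last r then ¬ b else b

theorem forall_admissible_iff {m : Fin (r + 1) → ℕ} :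
    (∀ i, Admissible (Y (m i)) i) ↔ (∀ i : Fin r, Y (m i.castSucc)) ∧ ¬ Y (m (Fin.last r)) := by
  simp [Fin.forall_fin_succ', Admissible, Fin.castSucc_ne_last]

/-- The possible configurations after `t` letters of tuples violating closedness of `Y`: the
state, and the set of the tapes that have not ended before time `t`. -/
def configs (t : ℕ) : Set (σ × Set (Fin (r + 1))) :=
  {p | ∃ m : Fin (r + 1) → ℕ, (∀ i, m i ≤ t) ∧ (∀ i, m i < t → Admissible (Y (m i)) i) ∧
    p.1 ∈ M.eval ((List.range t).map (padLetter m)) ∧ p.2 = {i | m i = t}}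

/-- The successors of a set of configurations, when `b` tells whether the present time is a
member. -/
def nextConfigs (C : Set (σ × Set (Fin (r + 1)))) (b : Prop) : Set (σ × Set (Fin (r + 1))) :=
  open Classical in
  {p' | ∃ p ∈ C, p'.2 ⊆ p.2 ∧ (∀ i ∈ p.2, i ∉ p'.2 → Admissible b i) ∧
    p'.1 ∈ M.step p.1 fun i => if i ∈ p'.2 then some () else none}

/-- Some configuration completes a violating tuple at the present time. -/
def BadConfigs (C : Set (σ × Set (Fin (r + 1)))) (b : Prop) : Prop :=
  ∃ p ∈ C, p.2.Nonempty ∧ (∀ i ∈ p.2, Admissible b i) ∧ p.1 ∈ M.accept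

theorem map_padLetter_congr {n t : ℕ} {m m' : Fin n → ℕ}
    (h : ∀ i, ∀ j < t, j < m i ↔ j < m' i) :
    (List.range t).map (padLetter m) = (List.range t).map (padLetter m') := by
  refine List.map_congr_left fun j hj => ?_
  funext i
  simp [padLetter, h i j (List.mem_range.1 hj)]

/-- A tape running at time `t` either ends there, and is tested against `Y t`, or reads one more
`a`; ended tapes read padding. -/
theorem configs_succ (t : ℕ) : configs M Y (t + 1) = nextConfigs M (configs M Y t) (Y t) := by
  ext ⟨q, s⟩
  constructor
  · rintro ⟨m, hle, hadm, hq, rfl⟩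
    rw [List.range_succ, List.map_append, List.map_singleton, NFA.eval_append_singleton,
      NFA.mem_stepSet] at hq
    obtain ⟨q₀, hq₀, hstep⟩ := hq
    -- Truncating at `t` merges the tapes of length `t` and `t + 1`, which look alike so far.
    refine ⟨(q₀, {i | min (m i) t = t}), ⟨fun i => min (m i) t, fun i => min_le_right _ _,
      fun i hi => ?_, ?_, rfl⟩, ?_, ?_, ?_⟩
    · dsimp only at hi ⊢
      have : min (m i) t = m i := by omega
      rw [this]
      exact hadm i (by omega)
    · rwa [map_padLetter_congr (m' := m) (fun i j hj => by omega)]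
    · intro i hi
      simp only [Set.mem_ofPred_eq] at hi ⊢
      omega
    · intro i hi hi'
      have h := hle i
      simp only [Set.mem_ofPred_eq] at hi hi'
      have : m i = t := by omega
      have h2 := hadm i (by omega)
      rwa [this] at h2
    · convert hstep using 2
      funext i
      have h := hle i
      simp only [Set.mem_ofPred_eq, padLetter]
      congr 1
      exact propext ⟨by omega, by omega⟩
  · classical
    rintro ⟨⟨q₀, s₀⟩, ⟨m, hle, hadm, hq₀, hs₀⟩, hsub, hend, hstep⟩
    simp only at hs₀ hsub hend hstep hq₀
    subst hs₀
    refine ⟨fun i => if i ∈ s then t + 1 else m i, fun i => ?_, fun i hi => ?_, ?_, ?_⟩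
    · have := hle i
      dsimp only
      split <;> omega
    · dsimp only at hi ⊢
      split at hi
      · omega
      · next his =>
        rw [if_neg his]
        rcases (hle i).lt_or_eq with h | h
        · exact hadm i h
        · rw [h]; exact hend i h his
    · rw [List.range_succ, List.map_append, List.map_singleton, NFA.eval_append_singleton,
        NFA.mem_stepSet]
      refine ⟨q₀, ?_, ?_⟩
      · rw [map_padLetter_congr (m' := m)]
        · exact hq₀
        · intro i j hj
          by_cases his : i ∈ s
          · have : m i = t := hsub his
            simp only [his, if_true]; omega
          · simp only [his, if_false]
      · convert hstep using 2
        funext i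
        have := hle i
        by_cases his : i ∈ s
        · simp [padLetter, his]
        · simp [padLetter, his]; omega
    · ext i
      have := hle i
      by_cases his : i ∈ s
      · simp [his]
      · simp [his]; omega

/-- Some tape still runs at `t`, so a violating tuple is detected exactly at the length of its
longest word. -/
theorem badConfigs_iff (t : ℕ) : BadConfigs M (configs M Y t) (Y t) ↔
    ∃ m : Fin (r + 1) → ℕ, Finset.univ.sup m = t ∧ (∀ i, Admissible (Y (m i)) i) ∧
      padWord m ∈ M.accepts := by
  constructor
  · rintro ⟨⟨q, s⟩, ⟨m, hle, hadm, hq, hs⟩, ⟨i₀, hi₀⟩, hend, hacc⟩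
    simp only at hs hi₀ hend hacc hq
    subst hs
    have hsup : Finset.univ.sup m = t := le_antisymm (Finset.sup_le fun i _ => hle i)
      (by rw [← (show m i₀ = t from hi₀)]; exact Finset.le_sup (Finset.mem_univ i₀))
    refine ⟨m, hsup, fun i => ?_, q, hacc, ?_⟩
    · rcases (hle i).lt_or_eq with h | h
      · exact hadm i h
      · rw [h]; exact hend i h
    · rw [padWord, hsup]; exact hq
  · rintro ⟨m, hsup, hadm, q, hacc, hq⟩
    have hle : ∀ i, m i ≤ t := fun i => hsup ▸ Finset.le_sup (Finset.mem_univ i)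
    refine ⟨(q, {i | m i = t}), ⟨m, hle, fun i _ => hadm i, ?_, rfl⟩, ?_, ?_, hacc⟩
    · rw [padWord, hsup] at hq; exact hq
    · obtain ⟨i, -, hi⟩ := Finset.exists_mem_eq_sup Finset.univ Finset.univ_nonempty m
      exact ⟨i, hi.symm.trans hsup⟩
    · intro i hi
      have h := hadm i
      rwa [show m i = t from hi] at h

end Configurations

/-! ### Extending bounded closedness to full closedness -/

section Closedness

/-- `Y` is closed under the relations accepted by the automata in `l`, each given with its number
of inputs, as far as tuples of numbers below `T` are concerned. -/
def ClosedBelow (l : List (ℕ × AutomatonCode)) (T : ℕ) (Y : ℕ → Prop) : Prop :=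
  ∀ p ∈ l, ∀ m : Fin (p.1 + 1) → ℕ, (∀ i, m i < T) → (∀ i : Fin p.1, Y (m i.castSucc)) →
    padWord m ∈ (p.2.toNFA (p.1 + 1)).accepts → Y (m (Fin.last p.1))

/-- A bound for the number of sets of configurations of the automata in `l`. -/
def configBound (l : List (ℕ × AutomatonCode)) : ℕ :=
  l.foldr (fun p s => 2 ^ (p.2.states * 2 ^ (p.1 + 1)) * s) 1

theorem configBound_eq_prod (l : List (ℕ × AutomatonCode)) :
    configBound l = (l.map fun p => 2 ^ (p.2.states * 2 ^ (p.1 + 1))).prod := by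
  induction l with
  | nil => rfl
  | cons p l ih => simp [configBound, ← ih]

theorem card_configs (l : List (ℕ × AutomatonCode)) :
    Nat.card (∀ j : Fin l.length, Set (Fin (l.get j).2.states × Set (Fin ((l.get j).1 + 1)))) =
      configBound l := by
  classical
  rw [configBound_eq_prod, Nat.card_eq_fintype_card, Fintype.card_pi,
    ← List.ofFn_get (l.map _), List.prod_ofFn]
  refine Fintype.prod_equiv (finCongr (by simp)) _ _ fun j => ?_
  simp [Fintype.card_set, Fintype.card_prod]

theorem not_bad_iff_closedBelow (l : List (ℕ × AutomatonCode)) (T : ℕ) (Y : ℕ → Prop) :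
    (∀ t < T, ¬ ∃ j : Fin l.length, BadConfigs ((l.get j).2.toNFA ((l.get j).1 + 1))
      (configs ((l.get j).2.toNFA ((l.get j).1 + 1)) Y t) (Y t)) ↔ ClosedBelow l T Y := by
  simp only [badConfigs_iff, forall_admissible_iff]
  constructor
  · intro h p hp m hm hin hacc
    obtain ⟨j, rfl⟩ := List.mem_iff_get.1 hp
    by_contra hout
    obtain ⟨i, -, hi⟩ := Finset.exists_mem_eq_sup Finset.univ Finset.univ_nonempty m
    exact h _ (hi ▸ hm i) ⟨j, m, rfl, ⟨hin, hout⟩, hacc⟩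
  · rintro h t ht ⟨j, m, hsup, ⟨hin, hout⟩, hacc⟩
    refine hout (h _ (List.get_mem l j) m (fun i => ?_) hin hacc)
    exact lt_of_le_of_lt (Finset.le_sup (Finset.mem_univ i)) (hsup ▸ ht)

theorem exists_closed_extension (l : List (ℕ × AutomatonCode)) {B T : ℕ}
    (hT : B + configBound l ≤ T) (Y : ℕ → Prop) (hY : ClosedBelow l T Y) :
    ∃ Z : ℕ → Prop, (∀ t < B, Z t ↔ Y t) ∧ ∀ T', ClosedBelow l T' Z := by
  let M (j : Fin l.length) := (l.get j).2.toNFA ((l.get j).1 + 1)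
  have hrun : ∀ (W : ℕ → Prop) (t : ℕ),
      -- At time `0` no tape has ended, so the membership predicate chosen here is irrelevant.
      safetyRun (fun j => configs (M j) (fun _ => False) 0)
        (fun C b j => nextConfigs (M j) (C j) b) W t = fun j => configs (M j) W t := by
    intro W t
    induction t with
    | zero => simp [safetyRun, configs]
    | succ t ih => simp only [safetyRun, ih, configs_succ]
  obtain ⟨Z, hZ, hgood⟩ := exists_safe_extension (B := B) (T := T)
    (fun j => configs (M j) (fun _ => False) 0) (fun C b j => nextConfigs (M j) (C j) b)
    (fun C b => ∃ j, BadConfigs (M j) (C j) b) Y (by rwa [card_configs])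
    (by simp only [hrun]; exact (not_bad_iff_closedBelow l T Y).2 hY)
  simp only [hrun] at hgood
  exact ⟨Z, hZ, fun T' => (not_bad_iff_closedBelow l T' Z).1 fun t _ => hgood t⟩

end Closedness

/-! ### Closed sets of lengths versus subalgebras -/

section Semantics

/-- All automata of a presentation, with their numbers of inputs. -/
def UnaryFACode.automata (d : UnaryFACode) : List (ℕ × AutomatonCode) := (1, d.eqAut) :: d.ops

theorem unit_replicate (x : List Unit) : List.replicate x.length () = x :=
  (List.eq_replicate_iff.2 ⟨rfl, fun _ _ => rfl⟩).symm

variable {L : FirstOrder.Language.{u, v}} {S : Type w} [L.Structure S]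
  {d : UnaryFACode} {e : Fin d.ops.length ≃ Σ k : ℕ, L.Functions k} {φ : List Unit → S}

open FirstOrder.Language in
theorem closedBelow_of_substructure (h : IsUnaryFAPresentation d e φ) (N : L.Substructure S)
    (T : ℕ) : ClosedBelow d.automata T fun t => φ (List.replicate t ()) ∈ N := by
  have key : ∀ {n : ℕ} {c : AutomatonCode} {R : Set (Fin n → List Unit)}, c.Recognizes R →
      ∀ m : Fin n → ℕ, padWord m ∈ (c.toNFA n).accepts → (fun i => List.replicate (m i) ()) ∈ R := by
    intro n c R hc m hm
    rw [← hc.iff]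
    simpa using hm
  intro p hp m _ hin hacc
  rcases List.mem_cons.1 hp with rfl | hp
  · have heq : φ _ = φ _ := key h.eq_recognizes m hacc
    have hin0 := hin 0
    simp only at hin0
    change φ (List.replicate (m 1) ()) ∈ N
    rw [← heq]
    exact hin0
  · obtain ⟨j, rfl⟩ := List.mem_iff_get.1 hp
    have hop := h.op_recognizes j
    have har := h.arity_eq j
    generalize d.ops.get j = p at *
    obtain ⟨k, c⟩ := p
    simp only at har
    subst har
    have hfun : Structure.funMap (e j).2 _ = φ _ := key hop m hacc
    rw [← hfun]
    exact N.fun_mem _ _ hin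

open FirstOrder.Language in
-- The elements represented in `Y` form a subalgebra containing the generators. Closedness under
-- equality then passes from some representative of `φ x` in `Y` to `x` itself.
theorem mem_of_closed (h : IsUnaryFAPresentation d e φ) {Y : ℕ → Prop}
    (hY : ∀ T, ClosedBelow d.automata T Y) {X : List (List Unit)} (hX : ∀ y ∈ X, Y y.length)
    {x : List Unit} (hx : φ x ∈ Substructure.closure L (φ '' {y | y ∈ X})) : Y x.length := by
  have closed : ∀ p ∈ d.automata, ∀ z : Fin (p.1 + 1) → List Unit,
      (∀ i : Fin p.1, Y (z i.castSucc).length) →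
      padWord (fun i => (z i).length) ∈ (p.2.toNFA (p.1 + 1)).accepts →
      Y (z (Fin.last p.1)).length := by
    intro p hp z hin hacc
    exact hY (Finset.univ.sup (fun i => (z i).length) + 1) p hp _ (fun i => Nat.lt_succ_of_le
      (Finset.le_sup (f := fun i => (z i).length) (Finset.mem_univ i))) hin hacc
  have sat : ∀ y z : List Unit, φ y = φ z → Y y.length → Y z.length := by
    intro y z hyz hy
    refine closed (1, d.eqAut) List.mem_cons_self ![y, z] (fun i => ?_) ?_
    · rw [Subsingleton.elim i 0]; exact hy
    · exact (h.eq_recognizes.iff _).2 hyz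
  let N : L.Substructure S :=
    { carrier := φ '' {y | Y y.length}
      fun_mem := by
        intro n f a ha
        choose z hz hφ using ha
        obtain ⟨y, hy⟩ := h.surjective (Structure.funMap f a)
        refine ⟨y, ?_, hy⟩
        obtain ⟨j, hj⟩ := e.surjective ⟨n, f⟩
        have hop := h.op_recognizes j
        have har := h.arity_eq j
        have hcl := closed _ (List.mem_cons_of_mem _ (List.get_mem d.ops j))
        generalize d.ops.get j = p at *
        obtain ⟨k, c⟩ := p
        simp only at har hcl hop
        rw [hj] at hop har
        simp only at har hop
        subst har
        have := hcl (Fin.snoc (α := fun _ => List Unit) z y) (fun i => by simpa using hz i)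
          ((hop.iff _).2 ?_)
        · simpa using this
        · simp only [wordRel, Set.mem_ofPred_eq, Fin.snoc_castSucc, Fin.snoc_last, hφ, hy] }
  have hN : Substructure.closure L (φ '' {y | y ∈ X}) ≤ N := by
    rw [Substructure.closure_le]
    rintro _ ⟨y, hy, rfl⟩
    exact ⟨y, hX y hy, rfl⟩
  obtain ⟨y, hy, hyx⟩ := hN hx
  exact sat y x hyx hy

/-- A search bound for refuting that `x` is in the subalgebra generated by `X`. -/
def searchBound (d : UnaryFACode) (X : List (List Unit)) (x : List Unit) : ℕ :=
  (x :: X).foldr (fun y s => y.length + 1 + s) 0 + configBound d.automata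

theorem length_lt_foldr {A : Type*} {l : List (List A)} {y : List A} (hy : y ∈ l) :
    y.length < l.foldr (fun y s => y.length + 1 + s) 0 := by
  induction l with
  | nil => simp at hy
  | cons z l ih =>
    rcases List.mem_cons.1 hy with rfl | h
    · simp only [List.foldr_cons]; omega
    · have := ih h
      simp only [List.foldr_cons]; omega

open FirstOrder.Language in
theorem notMem_closure_iff (h : IsUnaryFAPresentation d e φ) (X : List (List Unit))
    (x : List Unit) :
    φ x ∉ Substructure.closure L (φ '' {y | y ∈ X}) ↔
      ∃ Y : ℕ → Prop, ClosedBelow d.automata (searchBound d X x) Y ∧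
        (∀ y ∈ X, Y y.length) ∧ ¬ Y x.length := by
  constructor
  · intro hx
    refine ⟨_, closedBelow_of_substructure h (Substructure.closure L (φ '' {y | y ∈ X})) _,
      fun y hy => ?_, ?_⟩
    · rw [unit_replicate]
      exact Substructure.subset_closure ⟨y, hy, rfl⟩
    · rwa [unit_replicate]
  · rintro ⟨Y, hY, hX, hYx⟩ hx
    -- Here `B` is the sum of all input lengths plus one each, so `Z` and `Y` agree on `x` and on
    -- `X`.
    obtain ⟨Z, hZ, hZc⟩ := exists_closed_extension d.automata (le_refl _) Y hY
    refine hYx ((hZ _ (length_lt_foldr List.mem_cons_self)).1 (mem_of_closed h hZc ?_ hx))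
    exact fun y hy => (hZ _ (length_lt_foldr (List.mem_cons_of_mem _ hy))).2 (hX y hy)

end Semantics

/-! ### The finite search and its correctness -/

section Algorithm

/-- The `t`-th letter of the convolution of words of lengths listed in `m`. -/
def letterAt (m : List ℕ) (t : ℕ) : List (Option Unit) :=
  m.map fun k => if t < k then some () else none

/-- The states that the automaton `c` can reach by reading the first `t` letters of the convolution
of words of lengths listed in `m`. -/
def AutomatonCode.reach (c : AutomatonCode) (m : List ℕ) (t : ℕ) : List ℕ :=
  t.rec (c.initial.filter (· < c.states)) fun t S => c.trans.filterMap fun e =>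
    if (e.1 ∈ S ∧ e.2.1 = letterAt m t) ∧ e.2.2 < c.states then some e.2.2 else none

/-- The automaton `c` accepts the convolution of words of lengths listed in `m`. -/
def AutomatonCode.AcceptsLengths (c : AutomatonCode) (m : List ℕ) : Prop :=
  ∃ q ∈ c.reach m (m.foldr max 0), q ∈ c.final

/-- The lists of length `n` with entries in `s`. -/
def tuples (s : List ℕ) (n : ℕ) : List (List ℕ) :=
  n.rec [[]] fun _ l => l.flatMap fun m => s.map fun a => a :: m

/-- The sublists of `[T - 1, …, 0]`. -/
def subsetsBelow (T : ℕ) : List (List ℕ) :=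
  T.rec [[]] fun t l => l ++ l.map fun m => t :: m

/-- The finite search showing that `x` is not in the subalgebra generated by `X`. -/
def Refutable (p : UnaryFACode × List (List Unit) × List Unit) : Prop :=
  ∃ Y ∈ subsetsBelow (searchBound p.1 p.2.1 p.2.2),
    ((∀ q ∈ p.1.automata, ∀ m ∈ tuples Y q.1, ∀ v ∈ List.range (searchBound p.1 p.2.1 p.2.2),
      ¬ q.2.AcceptsLengths (m ++ [v]) ∨ v ∈ Y) ∧
      ∀ y ∈ p.2.1, y.length ∈ Y) ∧ p.2.2.length ∉ Y

theorem mem_tuples {s : List ℕ} {n : ℕ} {m : List ℕ} :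
    m ∈ tuples s n ↔ m.length = n ∧ ∀ a ∈ m, a ∈ s := by
  induction n generalizing m with
  | zero =>
    change m ∈ [[]] ↔ _
    rw [List.mem_singleton, List.length_eq_zero_iff]
    exact ⟨fun h => ⟨h, by simp [h]⟩, fun h => h.1⟩
  | succ n ih =>
    have : tuples s (n + 1) = (tuples s n).flatMap fun m => s.map fun a => a :: m := rfl
    rw [this]
    simp only [List.mem_flatMap, List.mem_map, ih]
    constructor
    · rintro ⟨m, ⟨rfl, hm⟩, a, ha, rfl⟩
      exact ⟨rfl, by simpa using ⟨ha, hm⟩⟩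
    · rintro ⟨hl, hm⟩
      cases m with
      | nil => simp at hl
      | cons a m =>
        simp only [List.mem_cons, forall_eq_or_imp] at hm
        exact ⟨m, ⟨by simpa using hl, hm.2⟩, a, hm.1, rfl⟩

theorem exists_mem_subsetsBelow (Y : ℕ → Prop) (T : ℕ) :
    ∃ l ∈ subsetsBelow T, ∀ t, t ∈ l ↔ t < T ∧ Y t := by
  induction T with
  | zero => exact ⟨[], by simp [subsetsBelow], by simp⟩
  | succ T ih =>
    obtain ⟨l, hl, h⟩ := ih
    have : subsetsBelow (T + 1) = subsetsBelow T ++ (subsetsBelow T).map fun m => T :: m := rfl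
    rw [this]
    by_cases hT : Y T
    · refine ⟨T :: l, List.mem_append_right _ (List.mem_map.2 ⟨l, hl, rfl⟩), fun t => ?_⟩
      rw [List.mem_cons, h, Nat.lt_succ_iff_lt_or_eq]
      exact ⟨by rintro (rfl | h) <;> tauto, by tauto⟩
    · refine ⟨l, List.mem_append_left _ hl, fun t => ?_⟩
      rw [h, Nat.lt_succ_iff_lt_or_eq]
      exact ⟨by tauto, by rintro ⟨h | rfl, h'⟩ <;> tauto⟩

theorem letterAt_ofFn {n : ℕ} (m : Fin n → ℕ) (t : ℕ) :
    letterAt (List.ofFn m) t = List.ofFn (padLetter m t) := by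
  simp only [letterAt, List.map_ofFn]
  rfl

namespace AutomatonCode

theorem reach_succ (c : AutomatonCode) (m : List ℕ) (t : ℕ) :
    c.reach m (t + 1) = c.trans.filterMap fun e =>
      if (e.1 ∈ c.reach m t ∧ e.2.1 = letterAt m t) ∧ e.2.2 < c.states then some e.2.2
      else none := rfl

/-- A code may mention numbers that are not states; `toNFA` ignores them, so the simulation must
too. -/
theorem lt_of_mem_reach {c : AutomatonCode} {m : List ℕ} {t q : ℕ} (h : q ∈ c.reach m t) :
    q < c.states := by
  cases t with
  | zero => simpa using (List.mem_filter.1 h).2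
  | succ t =>
    simp only [reach_succ, List.mem_filterMap, Option.ite_none_right_eq_some,
      Option.some.injEq] at h
    obtain ⟨e, -, ⟨-, h⟩, rfl⟩ := h
    exact h

theorem mem_reach_iff (c : AutomatonCode) {n : ℕ} (m : Fin n → ℕ) (t : ℕ) (q : Fin c.states) :
    (q : ℕ) ∈ c.reach (List.ofFn m) t ↔
      q ∈ (c.toNFA n).eval ((List.range t).map (padLetter m)) := by
  induction t generalizing q with
  | zero => simp [reach, toNFA]
  | succ t ih =>
    rw [List.range_succ, List.map_append, List.map_singleton, NFA.eval_append_singleton,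
      NFA.mem_stepSet]
    simp only [reach_succ, List.mem_filterMap, Option.ite_none_right_eq_some,
      Option.some.injEq]
    constructor
    · rintro ⟨⟨p, x, q'⟩, hmem, ⟨⟨hp, hx⟩, -⟩, hq⟩
      simp only at hp hx hq
      subst hx hq
      refine ⟨⟨p, lt_of_mem_reach hp⟩, (ih _).1 hp, ?_⟩
      rwa [letterAt_ofFn] at hmem
    · rintro ⟨p, hp, hstep⟩
      exact ⟨(p, List.ofFn (padLetter m t), q), hstep,
        ⟨⟨(ih p).2 hp, (letterAt_ofFn m t).symm⟩, q.2⟩, rfl⟩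

theorem acceptsLengths_ofFn (c : AutomatonCode) {n : ℕ} (m : Fin n → ℕ) :
    c.AcceptsLengths (List.ofFn m) ↔ padWord m ∈ (c.toNFA n).accepts := by
  have hsup : (List.ofFn m).foldr max 0 = Finset.univ.sup m := by
    induction n with
    | zero => simp
    | succ n ih => simp [List.ofFn_succ, ih, Fin.univ_succ, Finset.sup_map, Function.comp_def]
  constructor
  · rintro ⟨q, hq, hf⟩
    rw [hsup] at hq
    exact ⟨⟨q, lt_of_mem_reach hq⟩, hf, (c.mem_reach_iff m _ _).1 hq⟩
  · rintro ⟨q, hf, hq⟩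
    exact ⟨q, hsup ▸ (c.mem_reach_iff m _ q).2 hq, hf⟩

end AutomatonCode

theorem refutable_iff (d : UnaryFACode) (X : List (List Unit)) (x : List Unit) :
    Refutable (d, X, x) ↔ ∃ Y : ℕ → Prop, ClosedBelow d.automata (searchBound d X x) Y ∧
      (∀ y ∈ X, Y y.length) ∧ ¬ Y x.length := by
  constructor
  · rintro ⟨Y, hY, ⟨hcl, hX⟩, hx⟩
    refine ⟨(· ∈ Y), fun p hp m hm hin hacc => ?_, hX, hx⟩
    refine (hcl p hp (List.ofFn fun i : Fin p.1 => m i.castSucc)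
      (mem_tuples.2 ⟨by simp, by simpa [List.mem_ofFn] using hin⟩) (m (Fin.last _))
      (List.mem_range.2 (hm _))).resolve_left (not_not_intro ?_)
    rw [← List.concat_eq_append, ← List.ofFn_succ']
    exact (p.2.acceptsLengths_ofFn m).2 hacc
  · rintro ⟨Z, hcl, hX, hx⟩
    obtain ⟨Y, hY, hYZ⟩ := exists_mem_subsetsBelow Z (searchBound d X x)
    have hlt : ∀ y ∈ x :: X, y.length < searchBound d X x :=
      fun y hy => Nat.lt_add_right _ (length_lt_foldr hy)
    refine ⟨Y, hY, ⟨fun p hp m hm v hv => ?_, fun y hy => ?_⟩, fun h => hx ((hYZ _).1 h).2⟩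
    · rw [← imp_iff_not_or]
      intro hacc
      obtain ⟨hlen, hmem⟩ := mem_tuples.1 hm
      obtain ⟨r, c⟩ := p
      simp only at hlen hacc
      subst hlen
      have hsnoc : m ++ [v] = List.ofFn (Fin.snoc (α := fun _ => ℕ) m.get v) := by
        rw [List.ofFn_succ', List.concat_eq_append]
        simp
      have hv' := List.mem_range.1 hv
      rw [hsnoc, AutomatonCode.acceptsLengths_ofFn] at hacc
      have hY' : ∀ i, m.get i < searchBound d X x ∧ Z (m.get i) :=
        fun i => (hYZ _).1 (hmem _ (List.get_mem m i))
      refine (hYZ v).2 ⟨hv', ?_⟩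
      have hout := hcl _ hp _ (Fin.lastCases (by simpa using hv') fun i => by
        simpa using (hY' i).1) (fun i => by simpa using (hY' i).2) hacc
      simpa using hout
    · exact (hYZ _).2 ⟨hlt y (List.mem_cons_of_mem _ hy), hX y hy⟩

end Algorithm

/-! ### Primitive recursiveness of the search -/

section Computability

open Primrec

variable {α β : Type*} [Primcodable α] [Primcodable β]

theorem PrimrecPred.exists_mem {f : α → List β} {R : α → β → Prop} (hf : Primrec f)
    (hR : PrimrecRel R) : PrimrecPred fun a => ∃ b ∈ f a, R a b :=
  hR.swap.exists_mem_list.comp hf .id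

theorem PrimrecPred.forall_mem {f : α → List β} {R : α → β → Prop} (hf : Primrec f)
    (hR : PrimrecRel R) : PrimrecPred fun a => ∀ b ∈ f a, R a b :=
  hR.swap.forall_mem_list.comp hf .id

theorem PrimrecPred.mem_list {f : α → List β} {g : α → β} (hf : Primrec f) (hg : Primrec g) :
    PrimrecPred fun a => g a ∈ f a :=
  (PrimrecPred.exists_mem hf (R := fun a b => b = g a)
    (Primrec.eq.comp snd (hg.comp fst))).of_eq fun a => by simp

namespace AutomatonCode

theorem primrec_equivProd : Primrec equivProd := Primrec.of_equiv

theorem primrec_states : Primrec states := fst.comp primrec_equivProd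

theorem primrec_initial : Primrec initial := fst.comp (snd.comp primrec_equivProd)

theorem primrec_final : Primrec final := fst.comp (snd.comp (snd.comp primrec_equivProd))

theorem primrec_trans : Primrec trans := snd.comp (snd.comp (snd.comp primrec_equivProd))

end AutomatonCode

theorem UnaryFACode.primrec_automata : Primrec automata :=
  have h : Primrec equivProd := Primrec.of_equiv
  list_cons.comp (pair (const 1) (fst.comp h)) (snd.comp h)

theorem primrec_letterAt : Primrec₂ letterAt := by
  refine list_map fst ?_
  unfold Primrec₂
  exact Primrec.ite (nat_lt.comp (snd.comp fst) snd) (const _) (const _)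

theorem AutomatonCode.primrec_reach :
    Primrec fun p : AutomatonCode × List ℕ × ℕ => p.1.reach p.2.1 p.2.2 := by
  have h : PrimrecPred fun q : (AutomatonCode × List ℕ × ℕ) × ℕ => q.2 < q.1.1.states :=
    nat_lt.comp snd (primrec_states.comp (fst.comp fst))
  have hzero : Primrec fun p : AutomatonCode × List ℕ × ℕ =>
      p.1.initial.filter (· < p.1.states) := by
    refine (listFilterMap (f := fun p : AutomatonCode × List ℕ × ℕ => p.1.initial)
      (g := fun p k => if k < p.1.states then some k else none)
      (primrec_initial.comp fst) (Primrec.ite h (option_some.comp snd) (const none))).of_eq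
        fun p => ?_
    rw [← List.filterMap_eq_filter]
    simp [Option.guard_def]
  have hsucc : Primrec₂ fun (p : AutomatonCode × List ℕ × ℕ) (q : ℕ × List ℕ) =>
      p.1.trans.filterMap fun e => if (e.1 ∈ q.2 ∧ e.2.1 = letterAt p.2.1 q.1) ∧
        e.2.2 < p.1.states then some e.2.2 else none := by
    refine listFilterMap (primrec_trans.comp (fst.comp fst)) ?_
    unfold Primrec₂
    refine Primrec.ite (PrimrecPred.and (PrimrecPred.and ?_ ?_) ?_)
      (option_some.comp (snd.comp (snd.comp snd))) (const none)
    · exact PrimrecPred.mem_list (snd.comp (snd.comp fst)) (fst.comp snd)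
    · exact Primrec.eq.comp (fst.comp (snd.comp snd)) (primrec_letterAt.comp
        (fst.comp (snd.comp (fst.comp fst))) (fst.comp (snd.comp fst)))
    · exact nat_lt.comp (snd.comp (snd.comp snd)) (primrec_states.comp (fst.comp (fst.comp fst)))
  exact nat_rec' (snd.comp snd) hzero hsucc

theorem AutomatonCode.primrecRel_acceptsLengths : PrimrecRel AcceptsLengths := by
  refine PrimrecPred.exists_mem (primrec_reach.comp (pair fst (pair snd ?_)))
    (PrimrecPred.mem_list (primrec_final.comp (fst.comp fst)) snd)
  exact list_foldr snd (const 0) (nat_max.comp (fst.comp snd) (snd.comp snd)).to₂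

theorem primrec_tuples : Primrec₂ tuples :=
  nat_rec' snd (const [[]]) (list_flatMap (snd.comp snd)
    (list_map (fst.comp (fst.comp fst)) (list_cons.comp snd (snd.comp fst)).to₂).to₂).to₂

theorem primrec_subsetsBelow : Primrec subsetsBelow :=
  nat_rec' .id (const [[]]) (list_append.comp (snd.comp snd)
    (list_map (snd.comp snd) (list_cons.comp (fst.comp (snd.comp fst)) snd).to₂)).to₂

theorem primrec_nat_pow : Primrec₂ ((· ^ ·) : ℕ → ℕ → ℕ) :=
  Primrec₂.unpaired'.1 Nat.Primrec.pow

theorem primrec_configBound : Primrec configBound := by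
  refine list_foldr .id (const 1) (nat_mul.comp (primrec_nat_pow.comp (const 2) (nat_mul.comp
    (AutomatonCode.primrec_states.comp (snd.comp (fst.comp snd)))
    (primrec_nat_pow.comp (const 2) (succ.comp (fst.comp (fst.comp snd))))))
    (snd.comp snd)).to₂

theorem primrec_foldr_length :
    Primrec fun l : List (List Unit) => l.foldr (fun y s => y.length + 1 + s) 0 := by
  have hadd : Primrec fun q : List Unit × ℕ => q.1.length + 1 + q.2 :=
    nat_add.comp (succ.comp (list_length.comp fst)) snd
  have hstep : Primrec₂ fun (_ : List (List Unit)) (q : List Unit × ℕ) =>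
      q.1.length + 1 + q.2 := hadd.comp snd
  exact list_foldr .id (const 0) hstep

theorem primrec_searchBound : Primrec fun p : UnaryFACode × List (List Unit) × List Unit =>
    searchBound p.1 p.2.1 p.2.2 :=
  nat_add.comp (primrec_foldr_length.comp (list_cons.comp (snd.comp snd) (fst.comp snd)))
    (primrec_configBound.comp (UnaryFACode.primrec_automata.comp fst))

theorem primrecPred_refutable : PrimrecPred Refutable := by
  refine PrimrecPred.exists_mem (primrec_subsetsBelow.comp primrec_searchBound)
    (PrimrecPred.and (PrimrecPred.and ?_ ?_) ?_)
  · refine PrimrecPred.forall_mem (UnaryFACode.primrec_automata.comp (fst.comp fst)) ?_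
    refine PrimrecPred.forall_mem (primrec_tuples.comp (snd.comp fst) (fst.comp snd)) ?_
    refine PrimrecPred.forall_mem
      (list_range.comp (primrec_searchBound.comp (fst.comp (fst.comp fst)))) ?_
    refine PrimrecPred.or (PrimrecPred.not ?_) ?_
    · exact AutomatonCode.primrecRel_acceptsLengths.comp (snd.comp (snd.comp (fst.comp fst)))
        (list_concat.comp (snd.comp fst) snd)
    · exact PrimrecPred.mem_list (snd.comp (fst.comp (fst.comp fst))) snd
  · exact PrimrecPred.forall_mem (fst.comp (snd.comp fst))
      (PrimrecPred.mem_list (snd.comp fst) (list_length.comp snd))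
  · exact (PrimrecPred.mem_list snd (list_length.comp (snd.comp (snd.comp fst)))).not

end Computability

theorem mainTheorem3 :
    ∃ f : UnaryFACode × List (List Unit) × List Unit →. Bool, Partrec f ∧
      ∀ (L : FirstOrder.Language.{u, v}) [L.IsAlgebraic] (S : Type w) [L.Structure S]
        (d : UnaryFACode) (e : Fin d.ops.length ≃ Σ k : ℕ, L.Functions k)
        (φ : List Unit → S),
        IsUnaryFAPresentation d e φ →
        ∀ (X : List (List Unit)) (x : List Unit),
          ∃ b ∈ f (d, X, x),
            (b = true ↔ φ x ∈ FirstOrder.Language.Substructure.closure L (φ '' {y | y ∈ X})) := by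
  obtain ⟨hdec, hprim⟩ := primrecPred_refutable
  refine ⟨fun p => Part.some !decide (Refutable p), (Primrec.not.comp hprim).to_comp.partrec,
    fun L _ S _ d e φ h X x => ⟨_, Part.mem_some _, ?_⟩⟩
  rw [← not_iff_not, notMem_closure_iff h, ← refutable_iff]
  simp
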